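/- Let $X$ be a planar truss (form diagram): a finite graph with vertex set $V$ and edge set $E$, realized in the plane by an injective map $p:V\to\mathbb R^2$ with straight edges that meet each other and the vertices only in common end points. Let $F$ be the set of connected components of the complement of the drawing (the faces, including the exterior one); orient every edge arbitrarily, and let $l(e),r(e)\in F$ be the faces on the left and on the right of the edge $e$. The force cosheaf $\mathcal F$ has stalks $\mathbb R^2$ over vertices, $\mathbb R$ over edges and $0$ over faces; for an edge $e$ from $u$ to $v$, the basis vector of $\mathcal F_e$ is sent to $p(v)-p(u)$. It is included in the constant cosheaf $\mathbb R^2_X$ (by the same vector over edges, by the identity over vertices), and $\mathcal G=\mathbb R^2_X/\mathcal F$ is the position cosheaf. A self-stress of $X$ is a $w\in\mathbb R^E$ such that at every vertex $v$ the net force $\sum_{e=uv} w_e\,(p(v)-p(u))$ is zero. A parallel realization of the dual complex $\tilde X$ (force diagram) is a map $\xi:F\to\mathbb R^2$ such that for every edge $e$ the vector $\xi(l(e))-\xi(r(e))$ is parallel to $e$ (possibly zero); $\mathbb R^2$ acts on these by global translation. Then sending a self-stress, respectively a parallel realization, to its homology class identifies the space of self-stresses with $H_1\mathcal F$ and the space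 of parallel realizations of $\tilde X$ with $H_2\mathcal G$; the global translations embed $\mathbb R^2$ in $H_2\mathcal G$; and there is an isomorphism of vector spaces $$H_2\mathcal G/\mathbb R^2\;\cong\;H_1\mathcal F ,$$ that is, a linear bijection between parallel realizations of $\tilde X$ up to global translation and self-stresses of $X$. It sends the class of $\xi$ to the self-stress $w$ with $\xi(l(e))-\xi(r(e))=w_e\,(p(v)-p(u))$ for every edge $e$ from $u$ to $v$. -/

import Mathlib

noncomputable section

/-- The Euclidean plane `ℝ²`. -/
abbrev Plane : Type := EuclideanSpace ℝ (Fin 2)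

/-- The counterclockwise rotation of the plane by a quarter turn. -/
def quarterTurn (d : Plane) : Plane := !₂[-(d 1), d 0]

/-- A planar truss (form diagram): a graph with vertex set `V` and edge set `E`, every edge
carrying an arbitrary orientation `tail e → head e`, realized in the plane by `pos`, with straight
edges that meet each other and the vertices only in common end points. -/
structure FormDiagram (V E : Type*) where
  tail : E → V
  head : E → V
  pos : V → Plane
  tail_ne_head : ∀ e, tail e ≠ head e
  pos_injective : Function.Injective pos
  vertex_on_edge : ∀ v e, pos v ∈ segment ℝ (pos (tail e)) (pos (head e)) →
    v = tail e ∨ v = head e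
  edge_inter_edge : ∀ e e', e ≠ e' →
    segment ℝ (pos (tail e)) (pos (head e)) ∩ segment ℝ (pos (tail e')) (pos (head e')) ⊆
      pos '' (({tail e, head e} : Set V) ∩ {tail e', head e'})

namespace FormDiagram

variable {V E : Type*} (X : FormDiagram V E)

/-- The closed straight segment that realizes the edge `e`. -/
def edgeSegment (e : E) : Set Plane := segment ℝ (X.pos (X.tail e)) (X.pos (X.head e))

/-- The vector from the tail to the head of an edge. -/
def edgeVec (e : E) : Plane := X.pos (X.head e) - X.pos (X.tail e)

/-- The midpoint of an edge. -/
def edgeMid (e : E) : Plane := midpoint ℝ (X.pos (X.tail e)) (X.pos (X.head e))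

/-- The part of the plane that is covered by the vertices and edges. -/
def drawing : Set Plane := Set.range X.pos ∪ ⋃ e, X.edgeSegment e

/-- The face cells: the connected components of the complement of the drawing, the unbounded
exterior region included. They are the vertices of the dual cell complex. -/
def Face : Type := ConnectedComponents ↥(X.drawingᶜ)

/-- The face that contains a given point off the drawing. -/
def faceOf (x : Plane) (hx : x ∉ X.drawing) : X.Face :=
  ConnectedComponents.mk (⟨x, hx⟩ : ↥(X.drawingᶜ))

theorem quarterTurn_edgeVec_ne (e : E) (s c : ℝ) (hs : s ≠ 0) :
    s • quarterTurn (X.edgeVec e) ≠ c • X.edgeVec e := by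
  intro h
  have h0 := congrArg (fun z : Plane => z 0) h
  have h1 := congrArg (fun z : Plane => z 1) h
  simp only [quarterTurn, PiLp.smul_apply, smul_eq_mul] at h0 h1
  simp at h0 h1
  set a := X.edgeVec e 0
  set b := X.edgeVec e 1
  have hab : s * (a ^ 2 + b ^ 2) = 0 := by linear_combination a * h1 - b * h0
  have hab' : a ^ 2 + b ^ 2 = 0 := by
    rcases mul_eq_zero.1 hab with h | h
    · exact absurd h hs
    · exact h
  have ha : a = 0 := by nlinarith [sq_nonneg a, sq_nonneg b]
  have hb : b = 0 := by nlinarith [sq_nonneg a, sq_nonneg b]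
  have hd : X.edgeVec e = 0 := by
    ext i
    fin_cases i
    · exact ha
    · exact hb
  exact X.tail_ne_head e (X.pos_injective (sub_eq_zero.1 hd)).symm

/-- All points close enough to the midpoint of an edge, on its perpendicular bisector and other
than the midpoint, are off the drawing. -/
theorem exists_side [Finite V] [Finite E] (e : E) (s : ℝ) (hs : s ≠ 0) :
    ∃ δ : ℝ, 0 < δ ∧ ∀ t : ℝ, 0 < t → t ≤ δ →
      X.edgeMid e + (t * s) • quarterTurn (X.edgeVec e) ∉ X.drawing := by
  have hmid : X.edgeMid e ∈ X.edgeSegment e := midpoint_mem_segment _ _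
  have hne : X.pos (X.tail e) ≠ X.pos (X.head e) :=
    fun h => X.tail_ne_head e (X.pos_injective h)
  have hmidv : X.edgeMid e ∉ Set.range X.pos := by
    rintro ⟨v, hv⟩
    have hv' : X.pos v ∈ segment ℝ (X.pos (X.tail e)) (X.pos (X.head e)) := by
      rw [hv]; exact hmid
    rcases X.vertex_on_edge v e hv' with rfl | rfl
    · exact hne ((midpoint_eq_left_iff (R := ℝ)).1 hv.symm)
    · exact hne ((midpoint_eq_right_iff (R := ℝ)).1 hv.symm)
  have hmide : X.edgeMid e ∉ ⋃ e' : {e' // e' ≠ e}, X.edgeSegment e'.1 := by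
    intro h
    obtain ⟨⟨e', he'⟩, h'⟩ := Set.mem_iUnion.1 h
    obtain ⟨v, -, hv⟩ := X.edge_inter_edge e e' he'.symm ⟨hmid, h'⟩
    exact hmidv ⟨v, hv⟩
  have hseg : ∀ e', IsClosed (X.edgeSegment e') := by
    intro e'
    have : IsCompact (X.edgeSegment e') := by
      unfold edgeSegment
      rw [segment_eq_image_lineMap]
      exact isCompact_Icc.image AffineMap.lineMap_continuous
    exact this.isClosed
  have hcl : IsClosed (Set.range X.pos ∪ ⋃ e' : {e' // e' ≠ e}, X.edgeSegment e'.1) :=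
    (Set.finite_range X.pos).isClosed.union (isClosed_iUnion_of_finite fun e' => hseg e'.1)
  have hopen := hcl.isOpen_compl
  have hcont : Continuous fun t : ℝ => X.edgeMid e + (t * s) • quarterTurn (X.edgeVec e) := by
    fun_prop
  have hnh := (hopen.preimage hcont).mem_nhds (x := (0 : ℝ)) (by
    simp only [Set.mem_preimage, zero_mul, zero_smul, add_zero]
    rintro (h | h)
    · exact hmidv h
    · exact hmide h)
  obtain ⟨r, hr, hball⟩ := Metric.mem_nhds_iff.1 hnh
  refine ⟨r / 2, by positivity, fun t ht htr hmem => ?_⟩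
  have hout : X.edgeMid e + (t * s) • quarterTurn (X.edgeVec e) ∉
      Set.range X.pos ∪ ⋃ e' : {e' // e' ≠ e}, X.edgeSegment e'.1 :=
    hball (by simp only [Metric.mem_ball, Real.dist_eq, sub_zero, abs_of_pos ht]; linarith)
  rcases hmem with h | h
  · exact hout (Or.inl h)
  · obtain ⟨e', h'⟩ := Set.mem_iUnion.1 h
    by_cases hee : e' = e
    · subst hee
      unfold edgeSegment at h'
      rw [segment_eq_image'] at h'
      obtain ⟨c, -, hc⟩ := h'
      refine X.quarterTurn_edgeVec_ne e' (t * s) (c - 2⁻¹) (mul_ne_zero ht.ne' hs) ?_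
      have hm : X.edgeMid e' = X.pos (X.tail e') + (2⁻¹ : ℝ) • X.edgeVec e' := by
        simp only [edgeMid, edgeVec, midpoint_eq_smul_add, invOf_eq_inv]
        module
      have hc' : X.pos (X.tail e') + c • X.edgeVec e' =
          X.edgeMid e' + (t * s) • quarterTurn (X.edgeVec e') := hc
      rw [hm, add_assoc] at hc'
      have := add_left_cancel hc'
      rw [sub_smul, this]
      abel
    · exact hout (Or.inr (Set.mem_iUnion.2 ⟨⟨e', hee⟩, h'⟩))

section Sides

variable [Finite V] [Finite E]

/-- The face on the left of an oriented edge: it contains the points `mid + t • J d` for all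
small `t > 0`, with `mid` the midpoint and `d` the vector of the edge, `J` the counterclockwise
quarter turn. -/
def left (e : E) : X.Face :=
  X.faceOf (X.edgeMid e + ((X.exists_side e 1 one_ne_zero).choose * 1) •
      quarterTurn (X.edgeVec e))
    ((X.exists_side e 1 one_ne_zero).choose_spec.2 _
      (X.exists_side e 1 one_ne_zero).choose_spec.1 le_rfl)

/-- The face on the right of an oriented edge: it contains the points `mid - t • J d` for all
small `t > 0`. -/
def right (e : E) : X.Face :=
  X.faceOf (X.edgeMid e + ((X.exists_side e (-1) (neg_ne_zero.2 one_ne_zero)).choose * (-1)) •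
      quarterTurn (X.edgeVec e))
    ((X.exists_side e (-1) (neg_ne_zero.2 one_ne_zero)).choose_spec.2 _
      (X.exists_side e (-1) (neg_ne_zero.2 one_ne_zero)).choose_spec.1 le_rfl)

/-- The incidence `e ▷ v` of an edge and a vertex. -/
def EdgeVertex (e : E) (v : V) : Prop := v = X.tail e ∨ v = X.head e

/-- The incidence `f ▷ e` of a face and an edge. -/
def FaceEdge (f : X.Face) (e : E) : Prop := f = X.left e ∨ f = X.right e

end Sides

end FormDiagram

/-! ### Cellular cosheaves and their homology -/

/-- A cellular cosheaf of finite dimensional real vector spaces over the cell complex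
`(V, E, F)` of a form diagram. -/
structure Cosheaf {V E : Type*} [Finite V] [Finite E] (X : FormDiagram V E) where
  stalkV : V → Type
  stalkE : E → Type
  stalkF : X.Face → Type
  [groupV : ∀ v, AddCommGroup (stalkV v)]
  [groupE : ∀ e, AddCommGroup (stalkE e)]
  [groupF : ∀ f, AddCommGroup (stalkF f)]
  [moduleV : ∀ v, Module ℝ (stalkV v)]
  [moduleE : ∀ e, Module ℝ (stalkE e)]
  [moduleF : ∀ f, Module ℝ (stalkF f)]
  [finiteV : ∀ v, FiniteDimensional ℝ (stalkV v)]
  [finiteE : ∀ e, FiniteDimensional ℝ (stalkE e)]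
  [finiteF : ∀ f, FiniteDimensional ℝ (stalkF f)]
  mapEV : ∀ e v, X.EdgeVertex e v → (stalkE e →ₗ[ℝ] stalkV v)
  mapFE : ∀ f e, X.FaceEdge f e → (stalkF f →ₗ[ℝ] stalkE e)
  /-- The composite from a face to a vertex does not depend on the edge in between. -/
  functorial : ∀ f e e' v (hf : X.FaceEdge f e) (hv : X.EdgeVertex e v)
    (hf' : X.FaceEdge f e') (hv' : X.EdgeVertex e' v),
    mapEV e v hv ∘ₗ mapFE f e hf = mapEV e' v hv' ∘ₗ mapFE f e' hf'

namespace Cosheaf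

attribute [instance] groupV groupE groupF moduleV moduleE moduleF finiteV finiteE finiteF

variable {V E : Type*} [Finite V] {X : FormDiagram V E}

section Boundary

variable [Fintype E] (A : Cosheaf X)

/-- The space of cosheaf `0`-chains. -/
abbrev C₀ : Type _ := ∀ v, A.stalkV v

/-- The space of cosheaf `1`-chains. -/
abbrev C₁ : Type _ := ∀ e, A.stalkE e

/-- The space of cosheaf `2`-chains (there are finitely many faces). -/
abbrev C₂ : Type _ := ∀ f, A.stalkF f

open scoped Classical in
/-- The boundary map `C₁ → C₀`; the sign is `+` at the head of an edge and `-` at its tail. -/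
def boundary₁ : A.C₁ →ₗ[ℝ] A.C₀ :=
  LinearMap.pi fun v =>
    ∑ e : {e // v = X.head e}, A.mapEV e.1 v (Or.inr e.2) ∘ₗ LinearMap.proj e.1
      - ∑ e : {e // v = X.tail e}, A.mapEV e.1 v (Or.inl e.2) ∘ₗ LinearMap.proj e.1

/-- The boundary map `C₂ → C₁`; the sign is `+` for the face on the left of an edge and `-` for
the face on its right (the two contributions carry the same face if the edge is a bridge). -/
def boundary₂ : A.C₂ →ₗ[ℝ] A.C₁ :=
  LinearMap.pi fun e =>
    A.mapFE (X.left e) e (Or.inl rfl) ∘ₗ LinearMap.proj (X.left e)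
      - A.mapFE (X.right e) e (Or.inr rfl) ∘ₗ LinearMap.proj (X.right e)

/-- The boundary map into `C₂`; it is zero, since there are no `3`-cells. -/
def boundary₃ : PUnit.{1} →ₗ[ℝ] A.C₂ := 0

/-- `H₁ = ker ∂₁ / im ∂₂`. -/
abbrev H₁ : Type _ :=
  LinearMap.ker A.boundary₁ ⧸ (LinearMap.range A.boundary₂).submoduleOf (LinearMap.ker A.boundary₁)

/-- `H₂ = ker ∂₂ / im ∂₃`. -/
abbrev H₂ : Type _ :=
  LinearMap.ker A.boundary₂ ⧸ (LinearMap.range A.boundary₃).submoduleOf (LinearMap.ker A.boundary₂)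

end Boundary

/-- A map of cosheaves: stalkwise linear maps that commute with the cosheaf maps. -/
structure Hom [Finite E] (A B : Cosheaf X) where
  appV : ∀ v, A.stalkV v →ₗ[ℝ] B.stalkV v
  appE : ∀ e, A.stalkE e →ₗ[ℝ] B.stalkE e
  appF : ∀ f, A.stalkF f →ₗ[ℝ] B.stalkF f
  commEV : ∀ e v (h : X.EdgeVertex e v), appV v ∘ₗ A.mapEV e v h = B.mapEV e v h ∘ₗ appE e
  commFE : ∀ f e (h : X.FaceEdge f e), appE e ∘ₗ A.mapFE f e h = B.mapFE f e h ∘ₗ appF f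

/-- The quotient cosheaf `B / A` for a map `A → B` of cosheaves: its stalks are the quotients of
the stalks of `B` by the images of the stalks of `A`, its maps are induced by those of `B`. -/
abbrev quotient [Finite E] {A B : Cosheaf X} (φ : Hom A B) : Cosheaf X where
  stalkV v := B.stalkV v ⧸ LinearMap.range (φ.appV v)
  stalkE e := B.stalkE e ⧸ LinearMap.range (φ.appE e)
  stalkF f := B.stalkF f ⧸ LinearMap.range (φ.appF f)
  mapEV e v h := Submodule.mapQ _ _ (B.mapEV e v h) (by
    rintro _ ⟨x, rfl⟩
    exact ⟨A.mapEV e v h x, LinearMap.congr_fun (φ.commEV e v h) x⟩)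
  mapFE f e h := Submodule.mapQ _ _ (B.mapFE f e h) (by
    rintro _ ⟨x, rfl⟩
    exact ⟨A.mapFE f e h x, LinearMap.congr_fun (φ.commFE f e h) x⟩)
  functorial f e e' v hf hv hf' hv' := by
    ext x
    exact congrArg (Submodule.Quotient.mk (p := LinearMap.range (φ.appV v)))
      (LinearMap.congr_fun (B.functorial f e e' v hf hv hf' hv') x)

end Cosheaf

namespace FormDiagram

variable {V E : Type*} [Finite V]

section Cosheaves

variable [Finite E] (X : FormDiagram V E)

/-- The constant cosheaf `ℝ²_X`. -/
abbrev constantCosheaf : Cosheaf X where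
  stalkV _ := Plane
  stalkE _ := Plane
  stalkF _ := Plane
  mapEV _ _ _ := LinearMap.id
  mapFE _ _ _ := LinearMap.id
  functorial _ _ _ _ _ _ _ _ := rfl

/-- The force cosheaf: the stalks are `ℝ²` over vertices, `ℝ` over edges, zero over faces, and the
basis vector of an edge stalk is sent to the edge vector. Together with the sign in the boundary
map, an edge `e = uv` of stress `w` contributes the force `w (p(u) - p(v))` at the joint `u` and
the force `w (p(v) - p(u))` at the joint `v`. -/
abbrev forceCosheaf : Cosheaf X where
  stalkV _ := Plane
  stalkE _ := ℝ
  stalkF _ := PUnit.{1}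
  mapEV e _ _ := LinearMap.toSpanSingleton ℝ Plane (X.edgeVec e)
  mapFE _ _ _ := 0
  functorial _ _ _ _ _ _ _ _ := by simp

/-- The inclusion of the force cosheaf into the constant cosheaf. -/
def forceInclusion : Cosheaf.Hom X.forceCosheaf X.constantCosheaf where
  appV _ := LinearMap.id
  appE e := LinearMap.toSpanSingleton ℝ Plane (X.edgeVec e)
  appF _ := 0
  commEV _ _ _ := rfl
  commFE _ _ _ := by simp

/-- The position cosheaf: the quotient of the constant cosheaf by the force cosheaf. -/
abbrev positionCosheaf : Cosheaf X := Cosheaf.quotient X.forceInclusion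

end Cosheaves

variable [Fintype E] (X : FormDiagram V E)

open scoped Classical in
/-- The net force that the stresses `w` exert at the joint `v`: the sum of the forces
`w e • (p(v) - p(u))` over all edges `e` that join `v` to some joint `u`. -/
def netForce (w : E → ℝ) (v : V) : Plane :=
  ∑ e with X.head e = v, w e • (X.pos v - X.pos (X.tail e))
    + ∑ e with X.tail e = v, w e • (X.pos v - X.pos (X.head e))

/-- The self-stresses: assignments of stresses to the edges with zero net force at every joint. -/
def selfStresses : Submodule ℝ (E → ℝ) where
  carrier := {w | ∀ v, X.netForce w v = 0}
  zero_mem' v := by simp [netForce]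
  add_mem' {w w'} hw hw' v := by
    have h : X.netForce (w + w') v = X.netForce w v + X.netForce w' v := by
      simp only [netForce, Pi.add_apply, add_smul, Finset.sum_add_distrib]
      abel
    rw [h, hw v, hw' v, add_zero]
  smul_mem' c w hw v := by
    have h : X.netForce (c • w) v = c • X.netForce w v := by
      simp only [netForce, Pi.smul_apply, smul_eq_mul, mul_smul, smul_add, Finset.smul_sum]
    rw [h, hw v, smul_zero]

/-- The parallel realizations of the dual cell complex (force diagrams): assignments of positions
in the plane to the dual vertices (the faces) such that for each edge `e` the difference of the
positions of the two ends of the dual edge (the faces on the two sides of `e`) lies in the linear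
subspace parallel to `e`. -/
def parallelRealizations : Submodule ℝ (X.Face → Plane) where
  carrier := {ξ | ∀ e, ξ (X.left e) - ξ (X.right e) ∈ Submodule.span ℝ {X.edgeVec e}}
  zero_mem' e := by simp
  add_mem' {ξ η} hξ hη e := by
    have h := Submodule.add_mem _ (hξ e) (hη e)
    simpa only [Pi.add_apply, add_sub_add_comm] using h
  smul_mem' c ξ hξ e := by
    have h := Submodule.smul_mem _ c (hξ e)
    simpa only [Pi.smul_apply, smul_sub] using h

/-- The realization that places all dual vertices at the point `t`; adding it to a realization is
the global translation by `t`. -/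
def translation : Plane →ₗ[ℝ] X.parallelRealizations where
  toFun t := ⟨fun _ => t, fun e => by simp⟩
  map_add' _ _ := rfl
  map_smul' _ _ := rfl

theorem boundary₁_force (w : E → ℝ) : X.forceCosheaf.boundary₁ w = X.netForce w := by
  classical
  funext v
  have h1 : ∑ e : {e // v = X.head e}, w e.1 • X.edgeVec e.1 =
      ∑ e with X.head e = v, w e • (X.pos v - X.pos (X.tail e)) := by
    rw [Finset.sum_subtype (p := fun e => v = X.head e) _ (by simp [eq_comm])]
    refine Finset.sum_congr rfl ?_
    rintro ⟨e, rfl⟩ -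
    rfl
  have h2 : -∑ e : {e // v = X.tail e}, w e.1 • X.edgeVec e.1 =
      ∑ e with X.tail e = v, w e • (X.pos v - X.pos (X.head e)) := by
    rw [Finset.sum_subtype (p := fun e => v = X.tail e) _ (by simp [eq_comm]),
      ← Finset.sum_neg_distrib]
    refine Finset.sum_congr rfl ?_
    rintro ⟨e, rfl⟩ -
    simp only [edgeVec, ← smul_neg, neg_sub]
  rw [netForce, ← h1, ← h2, ← sub_eq_add_neg]
  simp only [Cosheaf.boundary₁, LinearMap.pi_apply, LinearMap.sub_apply, LinearMap.sum_apply]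
  rfl

/-- The `2`-chain of the position cosheaf with the given positions. -/
def positionChain : (X.Face → Plane) →ₗ[ℝ] X.positionCosheaf.C₂ :=
  LinearMap.pi fun f =>
    (LinearMap.range (X.forceInclusion.appF f)).mkQ ∘ₗ LinearMap.proj f

theorem boundary₂_positionChain (ξ : X.Face → Plane) (e : E) :
    X.positionCosheaf.boundary₂ (X.positionChain ξ) e =
      Submodule.Quotient.mk (p := LinearMap.range (X.forceInclusion.appE e))
        (ξ (X.left e) - ξ (X.right e)) := rfl

/-- The class in `H₁` of the force cosheaf of a self-stress. -/
def selfStressClass : X.selfStresses →ₗ[ℝ] X.forceCosheaf.H₁ :=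
  Submodule.mkQ _ ∘ₗ
    (LinearMap.codRestrict (LinearMap.ker X.forceCosheaf.boundary₁) X.selfStresses.subtype
      fun w => by
        rw [LinearMap.mem_ker]
        exact (X.boundary₁_force w.1).trans (funext w.2))

/-- The class in `H₂` of the position cosheaf of a parallel realization of the dual complex. -/
def realizationClass : X.parallelRealizations →ₗ[ℝ] X.positionCosheaf.H₂ :=
  Submodule.mkQ _ ∘ₗ
    (LinearMap.codRestrict (LinearMap.ker X.positionCosheaf.boundary₂)
      (X.positionChain ∘ₗ X.parallelRealizations.subtype) fun ξ => by
        rw [LinearMap.mem_ker]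
        funext e
        refine (X.boundary₂_positionChain ξ.1 e).trans ?_
        refine (Submodule.Quotient.mk_eq_zero _).2 ?_
        obtain ⟨c, hc⟩ := Submodule.mem_span_singleton.1 (ξ.2 e)
        exact ⟨c, hc⟩)

/-- The space `ℝ²` of global translations inside `H₂` of the position cosheaf. -/
def translationClass : Plane →ₗ[ℝ] X.positionCosheaf.H₂ := X.realizationClass ∘ₗ X.translation

end FormDiagram

end

/-! Identify `ℝ²` with `ℂ`. Beyond linear algebra, the content is that, with coefficients in `ℂ`,
the sequence constants → functions on faces → chains on edges → chains on vertices is exact at its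
two middle terms. The first of its nontrivial maps takes the jumps `ξ(l(e)) - ξ(r(e))`, the second
is the graph boundary `vertexSum`. For a chain of the form `w_e (p(v) - p(u))` the boundary at a
vertex is the net force. So the jumps of a parallel realization are a self-stress, every self-stress
arises in this way, and only the constants have no jumps.

Exactness is proved by complex analysis, without the Jordan curve theorem and without assuming the
graph connected. For an edge from `t` to `h` the map `x ↦ (h - x)/(t - x)` carries the open edge to
the negative real axis. Hence the principal logarithm of it has its cut exactly along the edge,
where it jumps by `2πi`. The potential `L_c = ∑ c_e log((h - x)/(t - x))` therefore jumps by `2πi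
c_e` across `e`, while its derivative `∑_v (∂c)_v / (x - v)` does not see the cuts.

If `c` is the family of jumps of `ξ`, then `ξ - L_c / (2πi)` extends holomorphically across the
edges (`hasDerivAt_correctedExtension`). Its derivative has a primitive around each vertex, so the
residues vanish and `∂c = 0` (`vertexSum_jump`). If `c = 0`, the function has zero derivative on the
connected complement of finitely many points, so `ξ` is constant (`eq_of_jump_eq_zero`). Conversely,
if `∂c = 0`, then `L_c` is locally constant off the drawing and `L_c / (2πi)` is a function on faces
with jumps `c` (`exists_jump_eq`).

The homology groups need no further geometry: the force cosheaf vanishes on faces and there are no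
3-cells, so neither group is divided by any nonzero boundary. -/

open Filter Topology

/-! ### Geometry of edges: the two sides and the faces next to them -/

namespace FormDiagram

variable {V E : Type*} (X : FormDiagram V E)

/-- The signed area spanned by the vector of an edge and the vector from its tail to a point; it
is positive on the left of the edge and negative on its right. -/
def cross (e : E) (y : Plane) : ℝ :=
  X.edgeVec e 0 * (y 1 - X.pos (X.tail e) 1) - X.edgeVec e 1 * (y 0 - X.pos (X.tail e) 0)

/-- The vertices and all edges except one. -/
def otherCells (e : E) : Set Plane :=
  Set.range X.pos ∪ ⋃ e' : {e' // e' ≠ e}, X.edgeSegment e'.1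

theorem pos_tail_ne_pos_head (e : E) : X.pos (X.tail e) ≠ X.pos (X.head e) :=
  fun h => X.tail_ne_head e (X.pos_injective h)

theorem edgeVec_ne_zero (e : E) : X.edgeVec e ≠ 0 :=
  fun h => X.pos_tail_ne_pos_head e (sub_eq_zero.1 h).symm

theorem isClosed_edgeSegment (e : E) : IsClosed (X.edgeSegment e) := by
  have : IsCompact (X.edgeSegment e) := by
    unfold edgeSegment
    rw [segment_eq_image_lineMap]
    exact isCompact_Icc.image AffineMap.lineMap_continuous
  exact this.isClosed

theorem isClosed_drawing [Finite V] [Finite E] : IsClosed X.drawing :=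
  (Set.finite_range X.pos).isClosed.union (isClosed_iUnion_of_finite X.isClosed_edgeSegment)

theorem isClosed_otherCells [Finite V] [Finite E] (e : E) : IsClosed (X.otherCells e) :=
  (Set.finite_range X.pos).isClosed.union
    (isClosed_iUnion_of_finite fun e' => X.isClosed_edgeSegment e'.1)

theorem mem_drawing_iff (e : E) (y : Plane) :
    y ∈ X.drawing ↔ y ∈ X.otherCells e ∨ y ∈ X.edgeSegment e := by
  simp only [drawing, otherCells, Set.mem_union, Set.mem_iUnion, or_assoc]
  refine or_congr Iff.rfl ⟨?_, ?_⟩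
  · rintro ⟨e', h⟩
    by_cases he : e' = e
    · exact Or.inr (he ▸ h)
    · exact Or.inl ⟨⟨e', he⟩, h⟩
  · rintro (⟨e', h⟩ | h)
    exacts [⟨e'.1, h⟩, ⟨e, h⟩]

theorem cross_add_smul (e : E) (a b : Plane) (s t : ℝ) (h : s + t = 1) :
    X.cross e (s • a + t • b) = s * X.cross e a + t * X.cross e b := by
  simp only [cross, PiLp.add_apply, PiLp.smul_apply, smul_eq_mul]
  obtain rfl : t = 1 - s := by linarith
  ring

theorem cross_eq_zero_of_mem {e : E} {y : Plane} (h : y ∈ X.edgeSegment e) : X.cross e y = 0 := by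
  obtain ⟨s, t, -, -, hst, rfl⟩ := h
  rw [cross_add_smul _ _ _ _ _ _ hst]
  simp only [cross, edgeVec, PiLp.sub_apply]
  ring

theorem sq_add_sq_edgeVec_pos (e : E) : 0 < X.edgeVec e 0 ^ 2 + X.edgeVec e 1 ^ 2 := by
  by_contra! h
  refine X.edgeVec_ne_zero e ?_
  have ha : X.edgeVec e 0 = 0 := by nlinarith [sq_nonneg (X.edgeVec e 0), sq_nonneg (X.edgeVec e 1)]
  have hb : X.edgeVec e 1 = 0 := by nlinarith [sq_nonneg (X.edgeVec e 0), sq_nonneg (X.edgeVec e 1)]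
  ext i
  fin_cases i
  exacts [ha, hb]

theorem cross_edgeMid_add (e : E) (t : ℝ) :
    X.cross e (X.edgeMid e + t • quarterTurn (X.edgeVec e)) =
      t * (X.edgeVec e 0 ^ 2 + X.edgeVec e 1 ^ 2) := by
  have hm : X.edgeMid e = X.pos (X.tail e) + (2⁻¹ : ℝ) • X.edgeVec e := by
    simp only [edgeMid, edgeVec, midpoint_eq_smul_add, invOf_eq_inv]
    module
  rw [hm]
  simp only [cross, quarterTurn, PiLp.add_apply, PiLp.smul_apply, smul_eq_mul]
  simp
  ring

theorem mem_openSegment_of_mem {e : E} {x : Plane} (hx : x ∈ X.edgeSegment e)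
    (hv : x ∉ Set.range X.pos) :
    x ∈ openSegment ℝ (X.pos (X.tail e)) (X.pos (X.head e)) :=
  mem_openSegment_of_ne_left_right (fun h => hv ⟨_, h⟩) (fun h => hv ⟨_, h⟩) hx

theorem notMem_range_of_mem_openSegment {e : E} {x : Plane}
    (hx : x ∈ openSegment ℝ (X.pos (X.tail e)) (X.pos (X.head e))) : x ∉ Set.range X.pos := by
  rintro ⟨v, rfl⟩
  rcases X.vertex_on_edge v e (openSegment_subset_segment _ _ _ hx) with rfl | rfl
  · exact X.pos_tail_ne_pos_head e (left_mem_openSegment_iff.1 hx)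
  · exact X.pos_tail_ne_pos_head e (right_mem_openSegment_iff.1 hx)

theorem eq_of_mem_edgeSegment {e e' : E} {x : Plane} (hx : x ∈ X.edgeSegment e)
    (hx' : x ∈ X.edgeSegment e') (hv : x ∉ Set.range X.pos) : e = e' := by
  by_contra h
  obtain ⟨v, -, h⟩ := X.edge_inter_edge e e' h ⟨hx, hx'⟩
  exact hv ⟨v, h⟩

theorem notMem_otherCells {e : E} {x : Plane} (hx : x ∈ X.edgeSegment e)
    (hv : x ∉ Set.range X.pos) : x ∉ X.otherCells e := by
  rintro (h | h)
  · exact hv h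
  · obtain ⟨e', h⟩ := Set.mem_iUnion.1 h
    exact e'.2 (X.eq_of_mem_edgeSegment h hx hv)

theorem edgeMid_mem_openSegment (e : E) :
    X.edgeMid e ∈ openSegment ℝ (X.pos (X.tail e)) (X.pos (X.head e)) :=
  ⟨2⁻¹, 2⁻¹, by norm_num, by norm_num, by norm_num, by
    simp only [edgeMid, midpoint_eq_smul_add, invOf_eq_inv, smul_add]⟩

theorem edgeMid_notMem_range (e : E) : X.edgeMid e ∉ Set.range X.pos :=
  X.notMem_range_of_mem_openSegment (X.edgeMid_mem_openSegment e)

theorem edgeMid_mem (e : E) : X.edgeMid e ∈ X.edgeSegment e := midpoint_mem_segment _ _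

theorem faceOf_eq_of_isPreconnected {S : Set Plane} (hS : IsPreconnected S)
    (hd : S ⊆ X.drawingᶜ) {x y : Plane} (hx : x ∈ S) (hy : y ∈ S) :
    X.faceOf x (hd hx) = X.faceOf y (hd hy) := by
  have hS' : IsPreconnected ((↑) ⁻¹' S : Set ↥(X.drawingᶜ)) := by
    rw [← Topology.IsInducing.subtypeVal.isPreconnected_image, Subtype.image_preimage_coe,
      Set.inter_eq_right.2 hd]
    exact hS
  exact ConnectedComponents.coe_eq_coe'.2 (hS'.subset_connectedComponent (x := ⟨y, hd hy⟩) hy hx)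

theorem isPreconnected_side {S : Set Plane} (hS : Convex ℝ S) (e : E) (s : ℝ) :
    IsPreconnected (S ∩ {y | 0 < s * X.cross e y}) := by
  refine (hS.inter ?_).isPreconnected
  intro a ha b hb t u ht hu htu
  simp only [Set.mem_ofPred_eq] at *
  rw [cross_add_smul _ _ _ _ _ _ htu, show s * (t * X.cross e a + u * X.cross e b) =
    t * (s * X.cross e a) + u * (s * X.cross e b) by ring]
  rcases ht.eq_or_lt with rfl | ht
  · obtain rfl : u = 1 := by linarith
    simpa using hb
  · have := mul_pos ht ha
    have := mul_nonneg hu hb.le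
    linarith

/-- The point on the perpendicular bisector of an edge, on the side given by the sign of `s`,
that represents the face on this side. -/
noncomputable def sidePoint [Finite V] [Finite E] (e : E) (s : ℝ) (hs : s ≠ 0) : Plane :=
  X.edgeMid e + ((X.exists_side e s hs).choose * s) • quarterTurn (X.edgeVec e)

theorem sidePoint_notMem [Finite V] [Finite E] (e : E) (s : ℝ) (hs : s ≠ 0) :
    X.sidePoint e s hs ∉ X.drawing :=
  (X.exists_side e s hs).choose_spec.2 _ (X.exists_side e s hs).choose_spec.1 le_rfl

/-- Near an inner point of an edge, the points on one side of the edge lie in the face that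
represents this side. -/
theorem eventually_faceOf_eq_side [Finite V] [Finite E] {e : E} {x : Plane}
    (hx : x ∈ X.edgeSegment e) (hv : x ∉ Set.range X.pos) (s : ℝ) (hs : s ≠ 0) :
    ∀ᶠ y in 𝓝 x, 0 < s * X.cross e y →
      ∃ hy : y ∉ X.drawing, X.faceOf y hy = X.faceOf _ (X.sidePoint_notMem e s hs) := by
  -- The part of `e` between `x` and the midpoint is compact and avoids all other cells, so a whole
  -- neighbourhood of it does. This neighbourhood carries the side chosen at the midpoint along the
  -- edge to `x`.
  have hsub : segment ℝ x (X.edgeMid e) ⊆ (X.otherCells e)ᶜ := fun y hy => by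
    have := (convex_openSegment (X.pos (X.tail e)) (X.pos (X.head e))).segment_subset
      (X.mem_openSegment_of_mem hx hv) (X.edgeMid_mem_openSegment e) hy
    exact X.notMem_otherCells (openSegment_subset_segment _ _ _ this)
      (X.notMem_range_of_mem_openSegment this)
  have hcpt : IsCompact (segment ℝ x (X.edgeMid e)) := by
    rw [segment_eq_image_lineMap]
    exact isCompact_Icc.image AffineMap.lineMap_continuous
  obtain ⟨ε, hε, hεsub⟩ := hcpt.exists_thickening_subset_open
    (X.isClosed_otherCells e).isOpen_compl hsub
  set T := Metric.thickening ε (segment ℝ x (X.edgeMid e)) with hT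
  have hTo : IsOpen T := Metric.isOpen_thickening
  have hTx : x ∈ T := Metric.self_subset_thickening hε _ (left_mem_segment _ _ _)
  have hTm : X.edgeMid e ∈ T := Metric.self_subset_thickening hε _ (right_mem_segment _ _ _)
  -- Inside `T` the drawing consists of `e` alone, and `cross` vanishes on `e`. So each half of the
  -- convex set `T` is a connected set off the drawing.
  have hside : T ∩ {y | 0 < s * X.cross e y} ⊆ X.drawingᶜ := by
    rintro y ⟨hyT, hy⟩ hyd
    rcases (X.mem_drawing_iff e y).1 hyd with h | h
    · exact hεsub hyT h
    · have hy' : 0 < s * X.cross e y := hy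
      rw [X.cross_eq_zero_of_mem h, mul_zero] at hy'
      exact hy'.false
  obtain ⟨hδ, hδd⟩ := (X.exists_side e s hs).choose_spec
  set δ := (X.exists_side e s hs).choose with hδdef
  have hcont : Continuous fun t : ℝ => X.edgeMid e + (t * s) • quarterTurn (X.edgeVec e) := by
    fun_prop
  have hev : ∀ᶠ t : ℝ in 𝓝[>] 0,
      X.edgeMid e + (t * s) • quarterTurn (X.edgeVec e) ∈ T ∧ t ∈ Set.Ioc 0 δ :=
    (((hcont.tendsto' 0 _ (by simp)).eventually (hTo.mem_nhds hTm)).filter_mono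
      nhdsWithin_le_nhds).and (Ioc_mem_nhdsGT hδ)
  -- A point common to the half of `T` and to the perpendicular path that ends at `sidePoint`; it
  -- links the two connected sets.
  obtain ⟨t, htT, ht0, htδ⟩ := hev.exists
  have hconn : IsPreconnected
      ((fun t : ℝ => X.edgeMid e + (t * s) • quarterTurn (X.edgeVec e)) '' Set.Ioc 0 δ) :=
    isPreconnected_Ioc.image _ hcont.continuousOn
  have hd : (fun t : ℝ => X.edgeMid e + (t * s) • quarterTurn (X.edgeVec e)) '' Set.Ioc 0 δ ⊆
      X.drawingᶜ := by
    rintro _ ⟨u, hu, rfl⟩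
    exact hδd u hu.1 hu.2
  have hts : X.edgeMid e + (t * s) • quarterTurn (X.edgeVec e) ∈
      T ∩ {y | 0 < s * X.cross e y} := by
    refine ⟨htT, ?_⟩
    simp only [Set.mem_ofPred_eq]
    rw [cross_edgeMid_add]
    have h1 := X.sq_add_sq_edgeVec_pos e
    have h2 : 0 < s * s := mul_self_pos.2 hs
    have := mul_pos (mul_pos ht0 h2) h1
    linarith
  filter_upwards [hTo.mem_nhds hTx] with y hyT hy
  refine ⟨hside ⟨hyT, hy⟩, ?_⟩
  have hTc : Convex ℝ T := (convex_segment x (X.edgeMid e)).thickening ε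
  refine (X.faceOf_eq_of_isPreconnected (X.isPreconnected_side hTc e s) hside
    ⟨hyT, hy⟩ hts).trans ?_
  exact X.faceOf_eq_of_isPreconnected hconn hd ⟨t, ⟨ht0, htδ⟩, rfl⟩ ⟨δ, ⟨hδ, le_rfl⟩, rfl⟩

theorem eventually_faceOf_eq_left [Finite V] [Finite E] {e : E} {x : Plane}
    (hx : x ∈ X.edgeSegment e) (hv : x ∉ Set.range X.pos) :
    ∀ᶠ y in 𝓝 x, 0 < X.cross e y → ∃ hy : y ∉ X.drawing, X.faceOf y hy = X.left e := by
  filter_upwards [X.eventually_faceOf_eq_side hx hv 1 one_ne_zero] with y hy h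
  exact hy (by linarith)

theorem eventually_faceOf_eq_right [Finite V] [Finite E] {e : E} {x : Plane}
    (hx : x ∈ X.edgeSegment e) (hv : x ∉ Set.range X.pos) :
    ∀ᶠ y in 𝓝 x, X.cross e y < 0 → ∃ hy : y ∉ X.drawing, X.faceOf y hy = X.right e := by
  filter_upwards [X.eventually_faceOf_eq_side hx hv (-1) (neg_ne_zero.2 one_ne_zero)] with y hy h
  exact hy (by linarith)

theorem tendsto_edgeMid_add (e : E) (s : ℝ) :
    Tendsto (fun t : ℝ => X.edgeMid e + (t * s) • quarterTurn (X.edgeVec e)) (𝓝[>] 0)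
      (𝓝 (X.edgeMid e)) := by
  have : Continuous fun t : ℝ => X.edgeMid e + (t * s) • quarterTurn (X.edgeVec e) := by fun_prop
  exact (this.tendsto' 0 _ (by simp)).mono_left nhdsWithin_le_nhds

theorem exists_notMem_drawing [Finite V] [Finite E] : ∃ x, x ∉ X.drawing := by
  have hc : IsCompact X.drawing := by
    refine (Set.finite_range X.pos).isCompact.union (isCompact_iUnion fun e => ?_)
    unfold edgeSegment
    rw [segment_eq_image_lineMap]
    exact isCompact_Icc.image AffineMap.lineMap_continuous
  exact (Set.ne_univ_iff_exists_notMem _).1 hc.ne_univ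

end FormDiagram

/-! ### The angle under which an edge is seen, and its logarithm -/

namespace FormDiagram

variable {V E : Type*} (X : FormDiagram V E)

/-- The identification of the Euclidean plane with the complex plane. -/
noncomputable def toComplex : Plane ≃ₗᵢ[ℝ] ℂ := Complex.orthonormalBasisOneI.repr.symm

theorem toComplex_re (y : Plane) : (toComplex y).re = y 0 := by
  simp [toComplex, Complex.orthonormalBasisOneI_repr_symm_apply]

theorem toComplex_im (y : Plane) : (toComplex y).im = y 1 := by
  simp [toComplex, Complex.orthonormalBasisOneI_repr_symm_apply]

/-- The position of a vertex in the complex plane. -/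
noncomputable def vertexPoint (v : V) : ℂ := toComplex (X.pos v)

/-- The ratio of the vectors from a point to the head and to the tail of an edge. The argument of
it is the angle under which the edge is seen. -/
noncomputable def ratio (e : E) (x : ℂ) : ℂ :=
  (X.vertexPoint (X.head e) - x) / (X.vertexPoint (X.tail e) - x)

theorem toComplex_ne_vertexPoint {y : Plane} (hv : y ∉ Set.range X.pos) (v : V) :
    X.vertexPoint v - toComplex y ≠ 0 :=
  fun h => hv ⟨v, toComplex.injective (sub_eq_zero.1 h)⟩

theorem ratio_im (e : E) (y : Plane) :
    (X.ratio e (toComplex y)).im =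
      X.cross e y / Complex.normSq (X.vertexPoint (X.tail e) - toComplex y) := by
  simp only [ratio, vertexPoint, Complex.div_im, Complex.sub_re, Complex.sub_im, toComplex_re,
    toComplex_im, cross, edgeVec, PiLp.sub_apply]
  ring

theorem ratio_im_nonneg_iff (e : E) {y : Plane} (hv : y ∉ Set.range X.pos) :
    0 ≤ (X.ratio e (toComplex y)).im ↔ 0 ≤ X.cross e y := by
  have h := Complex.normSq_pos.2 (X.toComplex_ne_vertexPoint hv (X.tail e))
  rw [ratio_im, le_div_iff₀ h, zero_mul]

theorem ratio_ne_zero (e : E) {y : Plane} (hv : y ∉ Set.range X.pos) :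
    X.ratio e (toComplex y) ≠ 0 :=
  div_ne_zero (X.toComplex_ne_vertexPoint hv _) (X.toComplex_ne_vertexPoint hv _)

theorem mem_edgeSegment_of_ratio {e : E} {y : Plane} (hv : y ∉ Set.range X.pos)
    (him : (X.ratio e (toComplex y)).im = 0) (hre : (X.ratio e (toComplex y)).re ≤ 0) :
    y ∈ X.edgeSegment e := by
  set r := -(X.ratio e (toComplex y)).re with hr
  have hr0 : 0 ≤ r := by linarith
  have h1 : X.ratio e (toComplex y) = -(r : ℂ) := by
    apply Complex.ext <;> simp [hr, him]
  have h2 : X.vertexPoint (X.head e) - toComplex y =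
      -(r : ℂ) * (X.vertexPoint (X.tail e) - toComplex y) := by
    rw [← h1, ratio, div_mul_cancel₀ _ (X.toComplex_ne_vertexPoint hv _)]
  have h3 : X.pos (X.head e) - y = (-r) • (X.pos (X.tail e) - y) := by
    apply toComplex.injective
    simpa [vertexPoint] using h2
  -- Solving `head - y = -r (tail - y)` for `y` gives these weights.
  refine ⟨r / (1 + r), 1 / (1 + r), by positivity, by positivity, by field_simp; ring, ?_⟩
  have h4 : X.pos (X.head e) = y + (-r) • (X.pos (X.tail e) - y) := by rw [← h3]; abel
  have h5 : (1 + r : ℝ) ≠ 0 := by positivity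
  rw [h4]
  have : (1 / (1 + r) : ℝ) * (1 + r) = 1 := by field_simp
  have h6 : y = ((1 / (1 + r) : ℝ) * (1 + r)) • y := by rw [this, one_smul]
  conv_rhs => rw [h6]
  match_scalars
  · field_simp
    ring
  · field_simp

/-- A ratio on the closed negative real axis would place the point on the segment, so the cut of the
principal logarithm pulls back to nothing but the edge. -/
theorem ratio_mem_slitPlane {e : E} {y : Plane} (hv : y ∉ Set.range X.pos)
    (he : y ∉ X.edgeSegment e) : X.ratio e (toComplex y) ∈ Complex.slitPlane := by
  by_contra h
  rw [Complex.mem_slitPlane_iff, not_or, not_lt, not_not] at h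
  exact he (X.mem_edgeSegment_of_ratio hv h.2 h.1)

theorem ratio_re_neg {e : E} {y : Plane} (hv : y ∉ Set.range X.pos)
    (he : y ∈ X.edgeSegment e) : (X.ratio e (toComplex y)).re < 0 := by
  obtain ⟨a, b, ha, hb, hab, rfl⟩ := X.mem_openSegment_of_mem he hv
  have h := X.toComplex_ne_vertexPoint hv (X.tail e)
  have hb' : (b : ℂ) ≠ 0 := by exact_mod_cast hb.ne'
  have hA : (a : ℂ) = 1 - b := by
    rw [← Complex.ofReal_one, ← Complex.ofReal_sub]; congr 1; linarith
  have : X.ratio e (toComplex (a • X.pos (X.tail e) + b • X.pos (X.head e))) =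
      ((-(a / b) : ℝ) : ℂ) := by
    rw [ratio, div_eq_iff h]
    simp only [vertexPoint, map_add, map_smul, Complex.real_smul, Complex.ofReal_neg,
      Complex.ofReal_div]
    field_simp
    rw [hA]
    ring
  rw [this, Complex.ofReal_re]
  have := div_pos ha hb
  linarith

theorem hasDerivAt_ratio (e : E) {y : Plane} (hv : y ∉ Set.range X.pos) :
    HasDerivAt (X.ratio e) (X.ratio e (toComplex y) *
      ((toComplex y - X.vertexPoint (X.head e))⁻¹ - (toComplex y - X.vertexPoint (X.tail e))⁻¹))
      (toComplex y) := by
  have ht := X.toComplex_ne_vertexPoint hv (X.tail e)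
  have hh := X.toComplex_ne_vertexPoint hv (X.head e)
  have h := ((hasDerivAt_id (toComplex y)).const_sub (X.vertexPoint (X.head e))).div
    ((hasDerivAt_id (toComplex y)).const_sub (X.vertexPoint (X.tail e))) ht
  refine h.congr_deriv ?_
  rw [← neg_sub (X.vertexPoint (X.head e)), ← neg_sub (X.vertexPoint (X.tail e)), inv_neg, inv_neg,
    ratio]
  simp only [id]
  field_simp

theorem hasDerivAt_log_ratio {e : E} {y : Plane} (hv : y ∉ Set.range X.pos)
    (he : y ∉ X.edgeSegment e) :
    HasDerivAt (fun x => Complex.log (X.ratio e x))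
      ((toComplex y - X.vertexPoint (X.head e))⁻¹ - (toComplex y - X.vertexPoint (X.tail e))⁻¹)
      (toComplex y) := by
  refine ((X.hasDerivAt_ratio e hv).clog (X.ratio_mem_slitPlane hv he)).congr_deriv ?_
  rw [mul_div_cancel_left₀ _ (X.ratio_ne_zero e hv)]

/-- The sign of the ratio cancels in the logarithmic derivative. This branch is regular on the edge
itself and has the same derivative there as the principal one has off the edge. -/
theorem hasDerivAt_log_neg_ratio {e : E} {y : Plane} (hv : y ∉ Set.range X.pos)
    (he : y ∈ X.edgeSegment e) :
    HasDerivAt (fun x => Complex.log (-X.ratio e x))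
      ((toComplex y - X.vertexPoint (X.head e))⁻¹ - (toComplex y - X.vertexPoint (X.tail e))⁻¹)
      (toComplex y) := by
  have hs : -X.ratio e (toComplex y) ∈ Complex.slitPlane := by
    refine Complex.mem_slitPlane_iff.2 (Or.inl ?_)
    have := X.ratio_re_neg hv he
    simpa using this
  refine ((X.hasDerivAt_ratio e hv).fun_neg.clog hs).congr_deriv ?_
  rw [neg_div_neg_eq, mul_div_cancel_left₀ _ (X.ratio_ne_zero e hv)]

theorem vertexPoint_injective : Function.Injective X.vertexPoint :=
  toComplex.injective.comp X.pos_injective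

theorem symm_notMem_range {x : ℂ} (hx : x ∉ Set.range X.vertexPoint) :
    toComplex.symm x ∉ Set.range X.pos := by
  rintro ⟨v, h⟩
  exact hx ⟨v, by rw [vertexPoint, h, toComplex.apply_symm_apply]⟩

/-- On the negative reals the principal argument is `π`, the limit from above. The axis thus belongs
with the upper half plane, which is the left side of the edge; `planeExtension` follows the same
convention. -/
theorem log_eq_log_neg_add {z : ℂ} (hz : z.re < 0) :
    Complex.log z = Complex.log (-z) +
      (if 0 ≤ z.im then 1 else -1) * (Real.pi * Complex.I) := by
  rw [Complex.log, Complex.log, norm_neg]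
  rcases lt_trichotomy z.im 0 with h | h | h
  · rw [if_neg h.not_ge, Complex.arg_neg_eq_arg_add_pi_of_im_neg h]
    push_cast
    ring
  · have hz' : z = ((z.re : ℝ) : ℂ) := Complex.ext (by simp) (by simp [h])
    have h1 : Complex.arg z = Real.pi := by rw [hz']; exact Complex.arg_ofReal_of_neg hz
    have h2 : Complex.arg (-z) = 0 := by
      rw [hz', ← Complex.ofReal_neg]
      exact Complex.arg_ofReal_of_nonneg (by linarith)
    rw [if_pos h.ge, h1, h2]
    push_cast
    ring
  · rw [if_pos h.le, Complex.arg_neg_eq_arg_sub_pi_of_im_pos h]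
    push_cast
    ring

/-! ### Logarithmic potentials of chains on the edges -/

section Potential

variable [Fintype E] (c : E → ℂ)

/-- The sum of the logarithmic potentials of the edges. -/
noncomputable def logPotential (x : ℂ) : ℂ := ∑ e, c e * Complex.log (X.ratio e x)

/-- The derivative of the logarithmic potential. -/
noncomputable def logPotentialDeriv (x : ℂ) : ℂ :=
  ∑ e, c e * ((x - X.vertexPoint (X.head e))⁻¹ - (x - X.vertexPoint (X.tail e))⁻¹)

open scoped Classical in
/-- The logarithmic potential with the branch cut moved away from an edge. -/
noncomputable def logPotentialAcross (e : E) (x : ℂ) : ℂ :=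
  ∑ e' ∈ Finset.univ.erase e, c e' * Complex.log (X.ratio e' x)
    + c e * Complex.log (-X.ratio e x)

theorem hasDerivAt_logPotential {y : Plane} (hy : y ∉ X.drawing) :
    HasDerivAt (X.logPotential c) (X.logPotentialDeriv c (toComplex y)) (toComplex y) := by
  refine HasDerivAt.fun_sum fun e _ => ?_
  exact (X.hasDerivAt_log_ratio (fun h => hy (Or.inl h))
    (fun h => hy (Or.inr (Set.mem_iUnion.2 ⟨e, h⟩)))).const_mul _

theorem hasDerivAt_logPotentialAcross {e : E} {y : Plane} (hy : y ∈ X.edgeSegment e)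
    (hv : y ∉ Set.range X.pos) :
    HasDerivAt (X.logPotentialAcross c e) (X.logPotentialDeriv c (toComplex y))
      (toComplex y) := by
  classical
  rw [logPotentialDeriv, ← Finset.sum_erase_add _ _ (Finset.mem_univ e)]
  refine HasDerivAt.fun_add ?_ ((X.hasDerivAt_log_neg_ratio hv hy).const_mul _)
  refine HasDerivAt.fun_sum fun e' he' => ?_
  exact (X.hasDerivAt_log_ratio hv fun h =>
    (Finset.mem_erase.1 he').1 (X.eq_of_mem_edgeSegment h hy hv)).const_mul _

/-- The two potentials differ only in the summand of `e`, where the ratio has negative real part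
near `y`. The sign change of the last term is the jump `2πi c e`. -/
theorem eventually_logPotential_eq [Finite V] {e : E} {y : Plane} (hy : y ∈ X.edgeSegment e)
    (hv : y ∉ Set.range X.pos) :
    ∀ᶠ x in 𝓝 y, X.logPotential c (toComplex x) = X.logPotentialAcross c e (toComplex x) +
      c e * ((if 0 ≤ X.cross e x then 1 else -1) * (Real.pi * Complex.I)) := by
  classical
  have h1 : ∀ᶠ x in 𝓝 y, x ∉ Set.range X.pos :=
    (Set.finite_range X.pos).isClosed.isOpen_compl.mem_nhds hv
  have hc : ContinuousAt (fun x => (X.ratio e (toComplex x)).re) y :=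
    Complex.continuous_re.continuousAt.comp
      ((X.hasDerivAt_ratio e hv).continuousAt.comp toComplex.continuous.continuousAt)
  have h2 : ∀ᶠ x in 𝓝 y, (X.ratio e (toComplex x)).re < 0 :=
    hc.eventually (Iio_mem_nhds (X.ratio_re_neg hv hy))
  filter_upwards [h1, h2] with x hx1 hx2
  rw [logPotential, ← Finset.sum_erase_add _ _ (Finset.mem_univ e), log_eq_log_neg_add hx2,
    logPotentialAcross]
  simp only [X.ratio_im_nonneg_iff e hx1]
  ring

open scoped Classical in
/-- The total coefficient at a vertex of a `1`-chain of the graph. -/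
noncomputable def vertexSum (v : V) : ℂ :=
  ∑ e with X.head e = v, c e - ∑ e with X.tail e = v, c e

/-- Collecting the poles vertex by vertex turns the graph boundary of `c` into the residues of the
derivative. -/
theorem logPotentialDeriv_eq [Fintype V] (x : ℂ) :
    X.logPotentialDeriv c x = ∑ v, X.vertexSum c v * (x - X.vertexPoint v)⁻¹ := by
  classical
  simp only [logPotentialDeriv, vertexSum, sub_mul, mul_sub, Finset.sum_sub_distrib,
    Finset.sum_mul]
  congr 1
  · rw [← Finset.sum_fiberwise Finset.univ X.head]
    refine Finset.sum_congr rfl fun v _ => Finset.sum_congr rfl fun e he => ?_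
    rw [(Finset.mem_filter.1 he).2]
  · rw [← Finset.sum_fiberwise Finset.univ X.tail]
    refine Finset.sum_congr rfl fun v _ => Finset.sum_congr rfl fun e he => ?_
    rw [(Finset.mem_filter.1 he).2]

/-- An edge vector is `p(v) - p(u)` at its head and the negative of the outward difference at its
tail, so the signs of the boundary match those of the forces. -/
theorem vertexSum_stress [Finite V] (w : E → ℝ) (v : V) :
    X.vertexSum (fun e => toComplex (w e • X.edgeVec e)) v = toComplex (X.netForce w v) := by
  classical
  rw [vertexSum, netForce, map_add, map_sum, map_sum, sub_eq_add_neg, ← Finset.sum_neg_distrib]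
  congr 1
  · refine Finset.sum_congr rfl fun e he => ?_
    rw [← (Finset.mem_filter.1 he).2, edgeVec]
  · refine Finset.sum_congr rfl fun e he => ?_
    rw [← (Finset.mem_filter.1 he).2, edgeVec, ← map_neg, ← smul_neg, neg_sub]

end Potential

end FormDiagram

/-! ### Jumps of functions on the faces are exactly the cycles of the graph -/

namespace FormDiagram

variable {V E : Type*} [Fintype V] [Fintype E] (X : FormDiagram V E)

theorem eventually_faceOf_eq {y : Plane} (hy : y ∉ X.drawing) :
    ∀ᶠ x in 𝓝 y, ∃ hx : x ∉ X.drawing, X.faceOf x hx = X.faceOf y hy := by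
  obtain ⟨r, hr, hball⟩ := Metric.isOpen_iff.1 X.isClosed_drawing.isOpen_compl y hy
  filter_upwards [Metric.ball_mem_nhds y hr] with x hx
  exact ⟨hball hx, X.faceOf_eq_of_isPreconnected (convex_ball y r).isPreconnected hball hx
    (Metric.mem_ball_self hr)⟩

open scoped Classical in
/-- A function on the faces as a function on the plane, with the value of the left face on
every edge. -/
noncomputable def planeExtension (ξ : X.Face → ℂ) (y : Plane) : ℂ :=
  if h : y ∉ X.drawing then ξ (X.faceOf y h)
  else if h' : ∃ e, y ∈ X.edgeSegment e then ξ (X.left h'.choose) else 0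

theorem planeExtension_of_notMem (ξ : X.Face → ℂ) {y : Plane} (hy : y ∉ X.drawing) :
    X.planeExtension ξ y = ξ (X.faceOf y hy) := dif_pos hy

theorem planeExtension_of_mem (ξ : X.Face → ℂ) {e : E} {y : Plane} (hy : y ∈ X.edgeSegment e)
    (hv : y ∉ Set.range X.pos) : X.planeExtension ξ y = ξ (X.left e) := by
  have hd : ¬ y ∉ X.drawing := not_not.2 (Or.inr (Set.mem_iUnion.2 ⟨e, hy⟩))
  have h : ∃ e, y ∈ X.edgeSegment e := ⟨e, hy⟩
  rw [planeExtension, dif_neg hd, dif_pos h, X.eq_of_mem_edgeSegment h.choose_spec hy hv]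

theorem eventually_planeExtension_eq (ξ : X.Face → ℂ) {e : E} {y : Plane}
    (hy : y ∈ X.edgeSegment e) (hv : y ∉ Set.range X.pos) :
    ∀ᶠ x in 𝓝 y, X.planeExtension ξ x =
      if 0 ≤ X.cross e x then ξ (X.left e) else ξ (X.right e) := by
  have h1 : ∀ᶠ x in 𝓝 y, x ∉ Set.range X.pos :=
    (Set.finite_range X.pos).isClosed.isOpen_compl.mem_nhds hv
  have hc : ContinuousAt (fun x => (X.ratio e (toComplex x)).re) y :=
    Complex.continuous_re.continuousAt.comp
      ((X.hasDerivAt_ratio e hv).continuousAt.comp toComplex.continuous.continuousAt)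
  have h2 : ∀ᶠ x in 𝓝 y, (X.ratio e (toComplex x)).re < 0 :=
    hc.eventually (Iio_mem_nhds (X.ratio_re_neg hv hy))
  filter_upwards [h1, h2, X.eventually_faceOf_eq_left hy hv, X.eventually_faceOf_eq_right hy hv]
    with x hx1 hx2 hl hr
  rcases lt_trichotomy (X.cross e x) 0 with h | h | h
  · obtain ⟨hx, hf⟩ := hr h
    rw [if_neg h.not_ge, X.planeExtension_of_notMem ξ hx, hf]
  · rw [if_pos h.ge]
    refine X.planeExtension_of_mem ξ (X.mem_edgeSegment_of_ratio hx1 ?_ hx2.le) hx1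
    rw [ratio_im, h, zero_div]
  · obtain ⟨hx, hf⟩ := hl h
    rw [if_pos h.le, X.planeExtension_of_notMem ξ hx, hf]

/-- The jumps of a function on the faces across the edges. -/
noncomputable def jump (ξ : X.Face → ℂ) (e : E) : ℂ := ξ (X.left e) - ξ (X.right e)

/-- The function on the plane that remains when the potential of its jumps is subtracted from a
function on the faces. -/
noncomputable def correctedExtension (ξ : X.Face → ℂ) (x : ℂ) : ℂ :=
  X.planeExtension ξ (toComplex.symm x)
    - (2 * Real.pi * Complex.I)⁻¹ * X.logPotential (X.jump ξ) x

theorem eventually_toComplex {p : ℂ → Prop} {y : Plane} (h : ∀ᶠ x in 𝓝 y, p (toComplex x)) :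
    ∀ᶠ x in 𝓝 (toComplex y), p x := by
  have := toComplex.symm.continuous.continuousAt (x := toComplex y)
  rw [ContinuousAt, toComplex.symm_apply_apply] at this
  filter_upwards [this.eventually h] with x hx
  rwa [toComplex.apply_symm_apply] at hx

/-- The corrected extension is holomorphic off the vertices: its jumps across the edges cancel. -/
theorem hasDerivAt_correctedExtension (ξ : X.Face → ℂ) {y : Plane} (hv : y ∉ Set.range X.pos) :
    HasDerivAt (X.correctedExtension ξ)
      (-((2 * Real.pi * Complex.I)⁻¹ * X.logPotentialDeriv (X.jump ξ) (toComplex y)))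
      (toComplex y) := by
  by_cases hy : y ∈ X.drawing
  · obtain ⟨e, he⟩ := Set.mem_iUnion.1 (hy.resolve_left hv)
    -- Adding or subtracting half of the jump turns either face value into the mean of the two, so a
    -- single formula holds on both sides of the edge and on it.
    refine ((((X.hasDerivAt_logPotentialAcross (X.jump ξ) he hv).const_mul
      (2 * Real.pi * Complex.I)⁻¹).const_sub
        ((ξ (X.left e) + ξ (X.right e)) / 2))).congr_of_eventuallyEq ?_
    refine eventually_toComplex ?_
    filter_upwards [X.eventually_planeExtension_eq ξ he hv,
      X.eventually_logPotential_eq (X.jump ξ) he hv] with x h1 h2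
    have hpi : (Real.pi : ℂ) ≠ 0 := by exact_mod_cast Real.pi_ne_zero
    rw [correctedExtension, toComplex.symm_apply_apply, h1, h2, jump]
    split_ifs
    · field_simp
      ring
    · field_simp
      ring
  · refine ((((X.hasDerivAt_logPotential (X.jump ξ) hy).const_mul
      (2 * Real.pi * Complex.I)⁻¹).const_sub
        (ξ (X.faceOf y hy)))).congr_of_eventuallyEq ?_
    refine eventually_toComplex ?_
    filter_upwards [X.eventually_faceOf_eq hy] with x ⟨hx, h⟩
    rw [correctedExtension, toComplex.symm_apply_apply, X.planeExtension_of_notMem ξ hx, h]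

theorem hasDerivAt_correctedExtension_complex (ξ : X.Face → ℂ) {x : ℂ}
    (hx : x ∉ Set.range X.vertexPoint) :
    HasDerivAt (X.correctedExtension ξ)
      (-((2 * Real.pi * Complex.I)⁻¹ * X.logPotentialDeriv (X.jump ξ) x)) x := by
  have := X.hasDerivAt_correctedExtension ξ (X.symm_notMem_range hx)
  rwa [toComplex.apply_symm_apply] at this

/-- The jumps of a function on the faces form a cycle of the graph. -/
theorem vertexSum_jump (ξ : X.Face → ℂ) (v : V) : X.vertexSum (X.jump ξ) v = 0 := by
  have hfin : (Set.range X.vertexPoint \ {X.vertexPoint v}).Finite :=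
    (Set.finite_range _).subset Set.sdiff_subset
  -- A circle around `v` that neither meets nor encloses another vertex. It may cross edges, since
  -- the corrected extension is holomorphic there.
  obtain ⟨r, hr, hball⟩ := Metric.nhds_basis_closedBall.mem_iff.1
    (hfin.isClosed.isOpen_compl.mem_nhds (x := X.vertexPoint v) fun h => h.2 rfl)
  have hout : ∀ u, u ≠ v → X.vertexPoint u ∉ Metric.closedBall (X.vertexPoint v) r :=
    fun u hu h => hball h ⟨⟨u, rfl⟩, fun h' => hu (X.vertexPoint_injective h')⟩
  have hsph : ∀ x ∈ Metric.sphere (X.vertexPoint v) r, x ∉ Set.range X.vertexPoint := by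
    rintro _ hx ⟨u, rfl⟩
    by_cases hu : u = v
    · subst hu
      simp only [Metric.mem_sphere, dist_self] at hx
      exact hr.ne hx
    · exact hout u hu (Metric.sphere_subset_closedBall hx)
  -- The derivative has a primitive on the circle, so its integral vanishes. The poles outside
  -- contribute nothing by Cauchy's theorem, and what is left is the residue at `v`.
  have h1 := circleIntegral.integral_eq_zero_of_hasDerivWithinAt hr.le fun x hx =>
    (X.hasDerivAt_correctedExtension_complex ξ (hsph x hx)).hasDerivWithinAt
      (s := Metric.sphere (X.vertexPoint v) r)
  have hint : ∀ u, ContinuousOn (fun x => X.vertexSum (X.jump ξ) u * (x - X.vertexPoint u)⁻¹)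
      (Metric.sphere (X.vertexPoint v) r) := fun u =>
    continuousOn_const.mul ((continuousOn_id.sub continuousOn_const).inv₀ fun x hx h =>
      hsph x hx ⟨u, (sub_eq_zero.1 h).symm⟩)
  have hterm : ∀ u, u ≠ v → (∮ x in C(X.vertexPoint v, r),
      X.vertexSum (X.jump ξ) u * (x - X.vertexPoint u)⁻¹) = 0 := by
    intro u hu
    have hd : ∀ x ∈ Metric.closedBall (X.vertexPoint v) r, x - X.vertexPoint u ≠ 0 :=
      fun x hx h => hout u hu (sub_eq_zero.1 h ▸ hx)
    have hdiff : DifferentiableOn ℂ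
        (fun x => X.vertexSum (X.jump ξ) u * (x - X.vertexPoint u)⁻¹)
        (Metric.closedBall (X.vertexPoint v) r) :=
      ((differentiableOn_id.sub_const _).inv hd).const_mul _
    exact Complex.circleIntegral_eq_zero_of_differentiable_on_off_countable hr.le
      Set.countable_empty hdiff.continuousOn fun x hx =>
        hdiff.differentiableAt (Filter.mem_of_superset (Metric.isOpen_ball.mem_nhds hx.1)
          Metric.ball_subset_closedBall)
  simp only [logPotentialDeriv_eq, ← neg_mul] at h1
  rw [circleIntegral.integral_const_mul, circleIntegral.integral_fun_sum fun u _ =>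
    (hint u).circleIntegrable hr.le, Finset.sum_eq_single v (fun u _ hu => hterm u hu) (by simp),
    circleIntegral.integral_const_mul, circleIntegral.integral_sub_center_inv _ hr.ne'] at h1
  have hne := Complex.two_pi_I_ne_zero
  simpa [hne, Complex.I_ne_zero, Real.pi_ne_zero] using h1

/-- A function on the faces without jumps is constant. -/
theorem eq_of_jump_eq_zero (ξ : X.Face → ℂ) (h : X.jump ξ = 0) (f g : X.Face) : ξ f = ξ g := by
  have hder : ∀ x ∈ (Set.range X.vertexPoint)ᶜ, HasDerivAt (X.correctedExtension ξ) 0 x :=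
    fun x hx => by
      refine (X.hasDerivAt_correctedExtension_complex ξ hx).congr_deriv ?_
      rw [h]
      simp [logPotentialDeriv]
  -- Only finitely many points are removed from a space of real dimension two. Paths may cross the
  -- edges, and this is how different faces are compared.
  have hconn : IsPreconnected (Set.range X.vertexPoint)ᶜ :=
    ((Set.finite_range X.vertexPoint).countable.isConnected_compl_of_one_lt_rank
      (by simp)).isPreconnected
  have hopen : IsOpen (Set.range X.vertexPoint)ᶜ :=
    (Set.finite_range X.vertexPoint).isClosed.isOpen_compl
  obtain ⟨⟨a, ha⟩, rfl⟩ := ConnectedComponents.surjective_coe f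
  obtain ⟨⟨b, hb⟩, rfl⟩ := ConnectedComponents.surjective_coe g
  have hoff : ∀ a, a ∉ X.drawing → toComplex a ∈ (Set.range X.vertexPoint)ᶜ := by
    rintro a ha ⟨v, hv⟩
    exact ha (Or.inl ⟨v, toComplex.injective hv⟩)
  have hval : ∀ a (ha : a ∉ X.drawing),
      X.correctedExtension ξ (toComplex a) = ξ (X.faceOf a ha) := fun a ha => by
    rw [correctedExtension, toComplex.symm_apply_apply, X.planeExtension_of_notMem ξ ha, h]
    simp [logPotential]
  refine (hval a ha).symm.trans (Eq.trans ?_ (hval b hb))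
  exact hopen.is_const_of_deriv_eq_zero hconn
    (fun x hx => (hder x hx).differentiableAt.differentiableWithinAt)
    (fun x hx => (hder x hx).deriv) (hoff a ha) (hoff b hb)

/-- The potential of a cycle is constant on each face. -/
theorem exists_logPotential_eq (c : E → ℂ) (hc : ∀ v, X.vertexSum c v = 0) :
    ∃ η : X.Face → ℂ, ∀ y (hy : y ∉ X.drawing),
      η (X.faceOf y hy) = X.logPotential c (toComplex y) := by
  have hder : ∀ y, y ∉ X.drawing → HasDerivAt (X.logPotential c) 0 (toComplex y) := fun y hy => by
    refine (X.hasDerivAt_logPotential c hy).congr_deriv ?_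
    rw [logPotentialDeriv_eq]
    simp [hc]
  have hloc : IsLocallyConstant
      fun y : ↥(X.drawingᶜ) => X.logPotential c (toComplex y.1) := by
    refine (IsLocallyConstant.iff_eventually_eq _).2 fun y => ?_
    obtain ⟨r, hr, hball⟩ := Metric.isOpen_iff.1 X.isClosed_drawing.isOpen_compl y.1 y.2
    filter_upwards [continuous_subtype_val.continuousAt (Metric.ball_mem_nhds y.1 hr)] with x hx
    have hd : ∀ z ∈ Metric.ball (toComplex y.1) r, HasDerivAt (X.logPotential c) 0 z := by
      intro z hz
      have hz' : toComplex.symm z ∈ Metric.ball y.1 r := by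
        rw [Metric.mem_ball] at hz ⊢
        rwa [← toComplex.dist_map, toComplex.apply_symm_apply]
      simpa using hder _ (hball hz')
    refine Metric.isOpen_ball.is_const_of_deriv_eq_zero
      (convex_ball (toComplex y.1) r).isPreconnected
      (fun z hz => (hd z hz).differentiableAt.differentiableWithinAt)
      (fun z hz => (hd z hz).deriv) ?_ (Metric.mem_ball_self hr)
    rw [Metric.mem_ball, toComplex.dist_map]
    exact hx
  -- Any representative of the face will do, because a locally constant function is constant on
  -- connected components.
  refine ⟨fun f => X.logPotential c (toComplex (ConnectedComponents.surjective_coe f).choose.1),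
    fun y hy => ?_⟩
  have hs := (ConnectedComponents.surjective_coe (X.faceOf y hy)).choose_spec
  have hm := ConnectedComponents.coe_eq_coe'.1 hs
  have := hloc.apply_eq_of_isPreconnected isPreconnected_connectedComponent hm
    mem_connectedComponent
  exact this

/-- The value of a potential on one side of an edge, in terms of the branch that is continuous
across the edge. -/
theorem logPotentialAcross_edgeMid (c : E → ℂ) {η : X.Face → ℂ}
    (hη : ∀ y (hy : y ∉ X.drawing), η (X.faceOf y hy) = X.logPotential c (toComplex y))
    (e : E) (s : ℝ) (f : X.Face) (k : ℂ) (hs : s ≠ 0)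
    (hf : ∀ᶠ y in 𝓝 (X.edgeMid e), 0 < s * X.cross e y →
      ∃ hy : y ∉ X.drawing, X.faceOf y hy = f)
    (hk : ∀ y, 0 < s * X.cross e y → (if 0 ≤ X.cross e y then (1 : ℂ) else -1) = k) :
    X.logPotentialAcross c e (toComplex (X.edgeMid e)) =
      η f - c e * (k * (Real.pi * Complex.I)) := by
  have hcont : ContinuousAt (fun y => X.logPotentialAcross c e (toComplex y)) (X.edgeMid e) :=
    (X.hasDerivAt_logPotentialAcross c (X.edgeMid_mem e)
      (X.edgeMid_notMem_range e)).continuousAt.comp toComplex.continuous.continuousAt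
  have hpath := X.tendsto_edgeMid_add e s
  -- Both sides are limits along the perpendicular towards the midpoint: the left by continuity
  -- across the edge, the right because the path stays in `f` near its end.
  refine tendsto_nhds_unique (hcont.tendsto.comp hpath) (tendsto_const_nhds.congr' ?_)
  filter_upwards [hpath.eventually hf, self_mem_nhdsWithin, hpath.eventually
    (X.eventually_logPotential_eq c (X.edgeMid_mem e) (X.edgeMid_notMem_range e))]
    with t h1 ht h2
  have hpos : 0 < s * X.cross e (X.edgeMid e + (t * s) • quarterTurn (X.edgeVec e)) := by
    rw [cross_edgeMid_add]
    have := mul_pos (mul_pos (Set.mem_Ioi.1 ht) (mul_self_pos.2 hs)) (X.sq_add_sq_edgeVec_pos e)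
    linarith
  obtain ⟨hy, rfl⟩ := h1 hpos
  rw [hη, h2, hk _ hpos, add_sub_cancel_right]
  rfl

/-- Every cycle of the graph is the family of jumps of a function on the faces. -/
theorem exists_jump_eq (c : E → ℂ) (hc : ∀ v, X.vertexSum c v = 0) :
    ∃ ξ : X.Face → ℂ, X.jump ξ = c := by
  obtain ⟨η, hη⟩ := X.exists_logPotential_eq c hc
  refine ⟨fun f => (2 * Real.pi * Complex.I)⁻¹ * η f, funext fun e => ?_⟩
  -- The branch that is continuous across `e` has one value at the midpoint. Computing it from
  -- either side and subtracting gives the jump `2πi c e`.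
  have hl := X.logPotentialAcross_edgeMid c hη e 1 (X.left e) 1 one_ne_zero
    (by simpa using X.eventually_faceOf_eq_left (X.edgeMid_mem e) (X.edgeMid_notMem_range e))
    fun y hy => if_pos (by linarith)
  have hr := X.logPotentialAcross_edgeMid c hη e (-1) (X.right e) (-1) (by norm_num)
    (by simpa using X.eventually_faceOf_eq_right (X.edgeMid_mem e) (X.edgeMid_notMem_range e))
    fun y hy => if_neg (by linarith)
  have h : η (X.left e) - η (X.right e) = 2 * Real.pi * Complex.I * c e := by
    linear_combination hr - hl
  rw [jump, ← mul_sub, h, inv_mul_cancel_left₀ Complex.two_pi_I_ne_zero]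

/-! ### From parallel realizations to self-stresses -/

/-- The stresses of the edges with the given differences of positions along the dual edges. -/
noncomputable def realizationStress : X.parallelRealizations →ₗ[ℝ] (E → ℝ) :=
  LinearMap.pi fun e => (‖X.edgeVec e‖ ^ 2)⁻¹ • (innerₛₗ ℝ (X.edgeVec e)) ∘ₗ
    (LinearMap.proj (R := ℝ) (φ := fun _ : X.Face => Plane) (X.left e) -
      LinearMap.proj (R := ℝ) (φ := fun _ : X.Face => Plane) (X.right e)) ∘ₗ X.parallelRealizations.subtype

/-- For a multiple of `d`, the quotient `⟨d, z⟩ / ‖d‖²` is the multiplier. Using it makes the stress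
linear in the realization without choosing coefficients. -/
theorem realizationStress_smul_edgeVec (ξ : X.parallelRealizations) (e : E) :
    X.realizationStress ξ e • X.edgeVec e = ξ.1 (X.left e) - ξ.1 (X.right e) := by
  obtain ⟨a, ha⟩ := Submodule.mem_span_singleton.1 (ξ.2 e)
  have h : X.realizationStress ξ e =
      (‖X.edgeVec e‖ ^ 2)⁻¹ * inner ℝ (X.edgeVec e) (ξ.1 (X.left e) - ξ.1 (X.right e)) := rfl
  have hne : ‖X.edgeVec e‖ ≠ 0 := norm_ne_zero_iff.2 (X.edgeVec_ne_zero e)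
  rw [h, ← ha, real_inner_smul_right, real_inner_self_eq_norm_sq]
  congr 1
  field_simp

theorem realizationStress_mem (ξ : X.parallelRealizations) :
    X.realizationStress ξ ∈ X.selfStresses := fun v => by
  apply toComplex.injective
  rw [map_zero, ← vertexSum_stress, ← X.vertexSum_jump (fun f => toComplex (ξ.1 f)) v]
  congr 1
  funext e
  rw [realizationStress_smul_edgeVec, map_sub, jump]

/-- The map from parallel realizations of the dual complex to self-stresses. -/
noncomputable def realizationToStress : X.parallelRealizations →ₗ[ℝ] X.selfStresses :=
  X.realizationStress.codRestrict _ X.realizationStress_mem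

theorem ker_realizationToStress :
    LinearMap.ker X.realizationToStress = LinearMap.range X.translation := by
  ext ξ
  rw [LinearMap.mem_ker]
  constructor
  · intro h
    have hs : X.realizationStress ξ = 0 := congrArg Subtype.val h
    obtain ⟨a, ha⟩ := X.exists_notMem_drawing
    have hj : X.jump (fun f => toComplex (ξ.1 f)) = 0 := by
      funext e
      rw [jump, ← map_sub, ← realizationStress_smul_edgeVec, hs]
      simp
    refine ⟨ξ.1 (X.faceOf a ha), Subtype.ext (funext fun f => ?_)⟩
    exact toComplex.injective (X.eq_of_jump_eq_zero _ hj _ f)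
  · rintro ⟨t, rfl⟩
    -- A translation has zero differences, and an edge vector is nonzero, so each stress is zero.
    apply Subtype.ext
    funext e
    have h := X.realizationStress_smul_edgeVec (X.translation t) e
    rw [show (X.translation t).1 (X.left e) = t from rfl,
      show (X.translation t).1 (X.right e) = t from rfl, sub_self] at h
    exact (smul_eq_zero.1 h).resolve_right (X.edgeVec_ne_zero e)

theorem realizationToStress_surjective : Function.Surjective X.realizationToStress := by
  intro w
  obtain ⟨η, hη⟩ := X.exists_jump_eq (fun e => toComplex (w.1 e • X.edgeVec e)) fun v => by
    rw [vertexSum_stress, w.2 v, map_zero]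
  have hξ : ∀ e, toComplex.symm (η (X.left e)) - toComplex.symm (η (X.right e)) =
      w.1 e • X.edgeVec e := fun e => by
    rw [← map_sub, ← toComplex.symm_apply_apply (w.1 e • X.edgeVec e)]
    exact congrArg _ (congrFun hη e)
  refine ⟨⟨fun f => toComplex.symm (η f), fun e => ?_⟩, Subtype.ext (funext fun e => ?_)⟩
  · exact Submodule.mem_span_singleton.2 ⟨w.1 e, (hξ e).symm⟩
  · refine smul_left_injective ℝ (X.edgeVec_ne_zero e) ?_
    exact (X.realizationStress_smul_edgeVec _ e).trans (hξ e)

/-! ### Comparison with the homology of the cosheaves -/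

theorem selfStressClass_bijective : Function.Bijective X.selfStressClass := by
  -- The face stalks of the force cosheaf are zero, so there are no boundaries to divide by.
  have hz : (LinearMap.range X.forceCosheaf.boundary₂).submoduleOf
      (LinearMap.ker X.forceCosheaf.boundary₁) = ⊥ := by
    refine (Submodule.eq_bot_iff _).2 ?_
    rintro ⟨w, hw⟩ ⟨a, ha⟩
    refine Subtype.ext (ha.symm.trans ?_)
    funext e
    exact sub_zero _
  constructor
  · refine (injective_iff_map_eq_zero _).2 fun w hw => ?_
    have := (Submodule.Quotient.mk_eq_zero _).1 hw
    rw [hz, Submodule.mem_bot] at this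
    have hw0 : w.1 = 0 := congrArg Subtype.val this
    exact Subtype.ext hw0
  · intro q
    obtain ⟨⟨w, hw⟩, rfl⟩ := Submodule.Quotient.mk_surjective _ q
    refine ⟨⟨w, fun v => ?_⟩, rfl⟩
    exact congrFun ((X.boundary₁_force w).symm.trans (LinearMap.mem_ker.1 hw)) v

theorem realizationClass_bijective : Function.Bijective X.realizationClass := by
  have hz : (LinearMap.range X.positionCosheaf.boundary₃).submoduleOf
      (LinearMap.ker X.positionCosheaf.boundary₂) = ⊥ := by
    refine (Submodule.eq_bot_iff _).2 ?_
    rintro ⟨w, hw⟩ ⟨a, ha⟩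
    exact Subtype.ext ha.symm
  constructor
  · refine (injective_iff_map_eq_zero _).2 fun ξ hξ => ?_
    have := (Submodule.Quotient.mk_eq_zero _).1 hξ
    rw [hz, Submodule.mem_bot] at this
    refine Subtype.ext (funext fun f => ?_)
    have hf : Submodule.Quotient.mk (p := LinearMap.range (X.forceInclusion.appF f)) (ξ.1 f) = 0 :=
      congrFun (congrArg Subtype.val this) f
    -- Over a face the inclusion of the force cosheaf is the zero map, so passing to the quotient
    -- stalk loses nothing.
    obtain ⟨a, ha⟩ := (Submodule.Quotient.mk_eq_zero _).1 hf
    exact ha.symm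
  · intro q
    obtain ⟨⟨c, hc⟩, rfl⟩ := Submodule.Quotient.mk_surjective _ q
    choose ξ hξ using fun f => Submodule.Quotient.mk_surjective _ (c f)
    have hpc : X.positionChain ξ = c := funext hξ
    refine ⟨⟨ξ, fun e => ?_⟩, ?_⟩
    · have h := X.boundary₂_positionChain ξ e
      -- Over an edge the quotient stalk is the plane modulo the edge direction, so the vanishing of
      -- the boundary is precisely the parallelism condition.
      rw [hpc, LinearMap.mem_ker.1 hc] at h
      obtain ⟨a, ha⟩ := (Submodule.Quotient.mk_eq_zero _).1 h.symm
      exact Submodule.mem_span_singleton.2 ⟨a, ha⟩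
    · exact congrArg (Submodule.Quotient.mk) (Subtype.ext hpc)

theorem translationClass_injective : Function.Injective X.translationClass := by
  -- At least one face is needed to read off the translation; the drawing is compact, so it does not
  -- fill the plane.
  obtain ⟨a, ha⟩ := X.exists_notMem_drawing
  refine X.realizationClass_bijective.1.comp fun s t h => ?_
  exact congrFun (congrArg Subtype.val h) (X.faceOf a ha)

end FormDiagram

theorem theorem1 {V E : Type*} [Fintype V] [Fintype E] (X : FormDiagram V E) :
    -- `H₁` of the force cosheaf is the space of self-stresses
    Function.Bijective X.selfStressClass ∧
    -- `H₂` of the position cosheaf is the space of parallel dual realizations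
    Function.Bijective X.realizationClass ∧
    -- `ℝ²` embeds in it as the global translations
    Function.Injective X.translationClass ∧
    -- the bijection, for stresses and realizations and for the homology spaces
    ∃ (Ψ : (X.parallelRealizations ⧸ LinearMap.range X.translation) ≃ₗ[ℝ] X.selfStresses)
      (Φ : (X.positionCosheaf.H₂ ⧸ LinearMap.range X.translationClass) ≃ₗ[ℝ] X.forceCosheaf.H₁),
      (∀ (ξ : X.parallelRealizations) (e : E),
        ξ.1 (X.left e) - ξ.1 (X.right e) =
          (Ψ (Submodule.Quotient.mk ξ)).1 e • (X.pos (X.head e) - X.pos (X.tail e))) ∧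
      (∀ ξ : X.parallelRealizations,
        Φ (Submodule.Quotient.mk (X.realizationClass ξ)) =
          X.selfStressClass (Ψ (Submodule.Quotient.mk ξ))) := by
  refine ⟨X.selfStressClass_bijective, X.realizationClass_bijective,
    X.translationClass_injective, ?_⟩
  let Ψ : (X.parallelRealizations ⧸ LinearMap.range X.translation) ≃ₗ[ℝ] X.selfStresses :=
    (Submodule.quotEquivOfEq _ _ X.ker_realizationToStress.symm).trans
      (X.realizationToStress.quotKerEquivOfSurjective X.realizationToStress_surjective)
  let R := LinearEquiv.ofBijective X.realizationClass X.realizationClass_bijective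
  -- `realizationClass` carries the translations onto the range of `translationClass`, hence it
  -- descends to the quotients. `Φ` is then `Ψ` transported along the two identifications with
  -- homology.
  let Q : (X.parallelRealizations ⧸ LinearMap.range X.translation) ≃ₗ[ℝ]
      (X.positionCosheaf.H₂ ⧸ LinearMap.range X.translationClass) :=
    Submodule.Quotient.equiv _ _ R (LinearMap.range_comp _ _).symm
  refine ⟨Ψ, Q.symm.trans (Ψ.trans
    (LinearEquiv.ofBijective X.selfStressClass X.selfStressClass_bijective)),
    fun ξ e => (X.realizationStress_smul_edgeVec ξ e).symm, fun ξ => ?_⟩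
  have hQ : Q.symm (Submodule.Quotient.mk (X.realizationClass ξ)) = Submodule.Quotient.mk ξ :=
    Q.symm_apply_eq.2 rfl
  rw [LinearEquiv.trans_apply, hQ]
  rfl
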